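/- **Setting.** Let $\mathcal L$ be a system of differential equations $L^\mu[u]=0$, $\mu=1,\dots,l$, for unknown functions $u=(u^1,\dots,u^m)$ of $x=(x_1,\dots,x_n)$. Let $G^{si}[u]$ ($s=1,\dots,p$, $i=1,\dots,n$) be differential functions of $u$ with $D_jG^{si}=D_iG^{sj}$ on the solutions of $\mathcal L$, where $D_i$ is the total derivative with respect to $x_i$. Let $\mathcal L_{\rm p}$ be the corresponding system determining an Abelian covering of $\mathcal L$: it consists of the equations $v^s_i=G^{si}[u]$ for the potentials $v^1,\dots,v^p$, together with those equations $L^\nu=0$, $\nu\in\mathcal N\subseteq\{1,\dots,l\}$, of $\mathcal L$ that are kept; the remaining equations of $\mathcal L$ are consequences of these. Write the potential equations as $\varepsilon(v^s_i-G^{si})=0$ with a fixed sign $\varepsilon\in\{1,-1\}$. A conserved vector of $\mathcal L_{\rm p}$ is an $n$-tuple $F$ of differential functions of $(u,v)$ with $D_iF^i=0$ on the solutions of $\mathcal L_{\rm p}$. It is trivial if it is the sum of a tuple vanishing on the solutions of $\mathcal L_{\rm p}$ and a tuple whose total divergence vanishes identically. Conservation laws are the classes of conserved vectors modulo trivial ones.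 A tuple $\lambda=(\bar\lambda^{si},\lambda^\nu)$ of differential functions of $(u,v)$ is a characteristic of a conservation law if some conserved vector $F$ of that law satisfies identically $$D_iF^i=\bar\lambda^{si}\,\varepsilon\,(v^s_i-G^{si})+\lambda^\nu L^\nu$$ (summation over repeated indices). **Proposition.** Let $\lambda=(\bar\lambda^{\sigma i},\lambda^\nu)$ be a characteristic of a conservation law of $\mathcal L_{\rm p}$ and let $s\in\{1,\dots,p\}$. Then $(\bar\lambda^{s1},\dots,\bar\lambda^{sn})$ is a conserved vector of $\mathcal L_{\rm p}$. Moreover, the tuple $\varepsilon\,\partial\lambda/\partial v^s=\varepsilon\,(\partial\bar\lambda^{\sigma i}/\partial v^s,\ \partial\lambda^\nu/\partial v^s)$ is a characteristic of exactly one conservation law of $\mathcal L_{\rm p}$, and this conserved vector belongs to that conservation law. Thus the characteristic is $\lambda_{v^s}$ if the left-hand sides of the potential equations are $v^s_i-G^{si}$, and $-\lambda_{v^s}$ if they are $G^{si}-v^s_i$. -/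

import Mathlib

open scoped ContDiff

noncomputable section

/-- Coordinates of the infinite-order jet space with `n` independent variables and dependent
variables indexed by `A`: `Sum.inl i` is `x_i`, and `Sum.inr (a, α)` is the derivative `u^a_α`. -/
abbrev JetVar (n : ℕ) (A : Type) : Type := Fin n ⊕ (A × (Fin n → ℕ))

/-- The infinite-order jet space `J^∞(x|u)`, with the product topology. -/
abbrev Jet (n : ℕ) (A : Type) : Type := JetVar n A → ℝ

/-- The multiindex `δ_i`. -/
def unitIndex {n : ℕ} (i : Fin n) : Fin n → ℕ := Pi.single i 1

/-- Differential functions on `Ω`: on `Ω` they are smooth functions of finitely many jet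
coordinates. (For open `Ω` the projection `S.restrict '' Ω` is open.) Values off `Ω` are
irrelevant. -/
def IsDiffFun {n : ℕ} {A : Type} (Ω : Set (Jet n A)) (f : Jet n A → ℝ) : Prop :=
  ∃ (S : Finset (JetVar n A)) (g : (S → ℝ) → ℝ),
    ContDiffOn ℝ ∞ g (S.restrict '' Ω) ∧ ∀ z ∈ Ω, f z = g (S.restrict z)

open Classical in
/-- The point `z` of the jet space with the value of its coordinate `q` replaced by `t`. -/
def setCoord {n : ℕ} {A : Type} (z : Jet n A) (q : JetVar n A) (t : ℝ) : Jet n A :=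
  fun r => if r = q then t else z r

/-- The partial derivative `∂f/∂q` with respect to the jet coordinate `q`. -/
def jetPartial {n : ℕ} {A : Type} (q : JetVar n A) (f : Jet n A → ℝ) (z : Jet n A) : ℝ :=
  deriv (fun t => f (setCoord z q t)) (z q)

/-- The total derivative `D_i f = ∂f/∂x_i + Σ u^a_{α+δ_i} ∂f/∂u^a_α`; for a differential function
on an open set only finitely many summands are nonzero at each point of that set. -/
def totalDeriv {n : ℕ} {A : Type} (i : Fin n) (f : Jet n A → ℝ) (z : Jet n A) : ℝ :=
  jetPartial (Sum.inl i) f z +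
    ∑ᶠ q : A × (Fin n → ℕ), z (Sum.inr (q.1, q.2 + unitIndex i)) * jetPartial (Sum.inr q) f z

/-- The total divergence `D_i F^i`. -/
def totalDiv {n : ℕ} {A : Type} (F : Fin n → Jet n A → ℝ) (z : Jet n A) : ℝ :=
  ∑ i, totalDeriv i (F i) z

/-- The partial derivative `∂f/∂x_i` of a function of `x`. -/
def partialX {n : ℕ} (i : Fin n) (f : (Fin n → ℝ) → ℝ) (x : Fin n → ℝ) : ℝ :=
  fderiv ℝ f x (Pi.single i 1)

/-- The mixed partial derivative `∂^{|α|}f / ∂x_1^{α_1} … ∂x_n^{α_n}`. -/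
def mixedPartial {n : ℕ} (α : Fin n → ℕ) (f : (Fin n → ℝ) → ℝ) : (Fin n → ℝ) → ℝ :=
  (List.finRange n).foldr (fun i h => (partialX i)^[α i] h) f

/-- The infinite jet at `x` of an `A`-tuple `w` of functions of `x`. -/
def jetOf {n : ℕ} {A : Type} (w : A → (Fin n → ℝ) → ℝ) (x : Fin n → ℝ) : Jet n A :=
  Sum.elim x (fun q => mixedPartial q.2 (w q.1) x)

/-! ### Auxiliary facts on differential functions -/

theorem IsDiffFun.mono_finset {n : ℕ} {A : Type} {Ω : Set (Jet n A)} {S T : Finset (JetVar n A)}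
    (h : S ⊆ T) {g : (S → ℝ) → ℝ} (hg : ContDiffOn ℝ ∞ g (S.restrict '' Ω)) :
    ContDiffOn ℝ ∞ (fun y : T → ℝ => g (fun s => y ⟨s.1, h s.2⟩)) (T.restrict '' Ω) := by
  refine hg.comp (ContDiff.contDiffOn (by fun_prop)) ?_
  rintro _ ⟨z, hz, rfl⟩
  exact ⟨z, hz, rfl⟩

theorem IsDiffFun.add {n : ℕ} {A : Type} {Ω : Set (Jet n A)} {f g : Jet n A → ℝ}
    (hf : IsDiffFun Ω f) (hg : IsDiffFun Ω g) : IsDiffFun Ω (f + g) := by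
  classical
  obtain ⟨S, f', hf', hfe⟩ := hf
  obtain ⟨T, g', hg', hge⟩ := hg
  refine ⟨S ∪ T, _, (IsDiffFun.mono_finset Finset.subset_union_left hf').add
    (IsDiffFun.mono_finset Finset.subset_union_right hg'), ?_⟩
  intro z hz
  simp only [Pi.add_apply, hfe z hz, hge z hz]
  rfl

theorem IsDiffFun.smul {n : ℕ} {A : Type} {Ω : Set (Jet n A)} {f : Jet n A → ℝ} (c : ℝ)
    (hf : IsDiffFun Ω f) : IsDiffFun Ω (c • f) := by
  obtain ⟨S, f', hf', hfe⟩ := hf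
  exact ⟨S, _, hf'.const_smul c, fun z hz => by simp [hfe z hz]⟩

theorem IsDiffFun.zero {n : ℕ} {A : Type} (Ω : Set (Jet n A)) :
    IsDiffFun Ω (0 : Jet n A → ℝ) :=
  ⟨∅, fun _ => 0, contDiffOn_const, fun _ _ => rfl⟩

theorem IsDiffFun.coord {n : ℕ} {A : Type} (Ω : Set (Jet n A)) (q : JetVar n A) :
    IsDiffFun Ω (fun z => z q) := by
  refine ⟨{q}, fun y => y ⟨q, by simp⟩, ContDiff.contDiffOn (by fun_prop), fun z _ => rfl⟩

/-- At each point of an open set, a differential function depends differentiably on every jet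
coordinate, and on all but finitely many of them trivially. -/
theorem IsDiffFun.partials {n : ℕ} {A : Type} {Ω : Set (Jet n A)} (hΩ : IsOpen Ω)
    {f : Jet n A → ℝ} (hf : IsDiffFun Ω f) {z : Jet n A} (hz : z ∈ Ω) :
    (∀ q, DifferentiableAt ℝ (fun t => f (setCoord z q t)) (z q)) ∧
      {q | jetPartial q f z ≠ 0}.Finite := by
  classical
  obtain ⟨S, g, hg, hfe⟩ := hf
  have hself : ∀ q, setCoord z q (z q) = z := fun q => by
    funext r
    by_cases h : r = q <;> simp [setCoord, h]
  have hopen : IsOpen (S.restrict '' Ω) := by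
    have : IsOpenMap (S.restrict : Jet n A → (S → ℝ)) := by
      intro V hV
      rw [isOpen_iff_forall_mem_open]
      rintro _ ⟨y, hy, rfl⟩
      let e : (S → ℝ) → Jet n A := fun b q => if h : q ∈ S then b ⟨q, h⟩ else y q
      have he : Continuous e := by
        refine continuous_pi fun q => ?_
        by_cases h : q ∈ S
        · simpa [e, h] using continuous_apply _
        · simpa [e, h] using continuous_const
      refine ⟨e ⁻¹' V, ?_, hV.preimage he, ?_⟩
      · intro b hb
        refine ⟨e b, hb, ?_⟩
        ext s
        simp [e]
      · have : e (S.restrict y) = y := by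
          ext q
          by_cases h : q ∈ S <;> simp [e, h]
        simpa [this] using hy
    exact this Ω hΩ
  have hev : ∀ q, (fun t => f (setCoord z q t)) =ᶠ[nhds (z q)]
      fun t => g (S.restrict (setCoord z q t)) := by
    intro q
    have hc : Continuous fun t => setCoord z q t := by
      refine continuous_pi fun r => ?_
      by_cases h : r = q
      · simpa [setCoord, h] using continuous_id'
      · simpa [setCoord, h] using continuous_const
    have : ∀ᶠ t in nhds (z q), setCoord z q t ∈ Ω := by
      refine hc.continuousAt.eventually_mem (hΩ.mem_nhds ?_)
      rwa [hself]
    filter_upwards [this] with t ht using hfe _ ht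
  constructor
  · intro q
    refine DifferentiableAt.congr_of_eventuallyEq ?_ (hev q)
    have hgd : DifferentiableAt ℝ g (S.restrict (setCoord z q (z q))) := by
      rw [hself]
      exact (hg.contDiffAt (hopen.mem_nhds ⟨z, hz, rfl⟩)).differentiableAt (by simp)
    refine hgd.comp (z q)
      (f := fun t => S.restrict (setCoord z q t)) ?_
    rw [differentiableAt_pi]
    intro s
    by_cases h : s.1 = q <;> simp [setCoord, h]
  · refine S.finite_toSet.subset ?_
    intro q hq
    by_contra hqS
    refine hq ?_
    unfold jetPartial
    have h1 := (hev q).deriv_eq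
    have h2 : (fun t => g (S.restrict (setCoord z q t))) =
        fun _ => g (S.restrict z) := by
      funext t
      congr 1
      ext s
      have : s.1 ≠ q := fun h => hqS (by simp [← h])
      simp [setCoord, this]
    rw [h2] at h1
    simpa using h1

theorem totalDeriv_add {n : ℕ} {A : Type} {Ω : Set (Jet n A)} (hΩ : IsOpen Ω)
    {f g : Jet n A → ℝ} (hf : IsDiffFun Ω f) (hg : IsDiffFun Ω g) (i : Fin n) {z : Jet n A}
    (hz : z ∈ Ω) : totalDeriv i (f + g) z = totalDeriv i f z + totalDeriv i g z := by
  have hp : ∀ q, jetPartial q (f + g) z = jetPartial q f z + jetPartial q g z := fun q =>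
    deriv_add ((hf.partials hΩ hz).1 q) ((hg.partials hΩ hz).1 q)
  have hfin : ∀ {h : Jet n A → ℝ}, IsDiffFun Ω h → (Function.support
      fun q : A × (Fin n → ℕ) => z (Sum.inr (q.1, q.2 + unitIndex i)) *
        jetPartial (Sum.inr q) h z).Finite := by
    intro h hh
    refine ((hh.partials hΩ hz).2.preimage (Sum.inr_injective.injOn)).subset ?_
    intro q hq
    exact right_ne_zero_of_mul hq
  simp only [totalDeriv, hp, mul_add]
  rw [finsum_add_distrib (hfin hf) (hfin hg)]
  ring

theorem totalDeriv_smul {n : ℕ} {A : Type} (c : ℝ) (f : Jet n A → ℝ) (i : Fin n) (z : Jet n A) :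
    totalDeriv i (c • f) z = c * totalDeriv i f z := by
  have hp : ∀ q, jetPartial q (c • f) z = c * jetPartial q f z := fun q => by
    simp [jetPartial, deriv_const_mul_field]
  simp only [totalDeriv, hp, mul_left_comm _ c, mul_add]
  congr 1
  simpa using (smul_finsum c (fun q : A × (Fin n → ℕ) =>
    z (Sum.inr (q.1, q.2 + unitIndex i)) * jetPartial (Sum.inr q) f z)).symm

theorem totalDiv_add {n : ℕ} {A : Type} {Ω : Set (Jet n A)} (hΩ : IsOpen Ω)
    {F G : Fin n → Jet n A → ℝ} (hF : ∀ i, IsDiffFun Ω (F i)) (hG : ∀ i, IsDiffFun Ω (G i))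
    {z : Jet n A} (hz : z ∈ Ω) : totalDiv (F + G) z = totalDiv F z + totalDiv G z := by
  simp only [totalDiv, Pi.add_apply, totalDeriv_add hΩ (hF _) (hG _) _ hz,
    Finset.sum_add_distrib]

theorem totalDiv_smul {n : ℕ} {A : Type} (c : ℝ) (F : Fin n → Jet n A → ℝ) (z : Jet n A) :
    totalDiv (c • F) z = c * totalDiv F z := by
  simp only [totalDiv, Pi.smul_apply, totalDeriv_smul, Finset.mul_sum]

/-! ### Systems of differential equations, conservation laws and characteristics -/

/-- A system of differential equations `eqn e = 0`, `e ∈ E`, for unknown functions indexed by `A`;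
the left-hand sides are differential functions on an open subset `dom` of the jet space. -/
structure DESystem (n : ℕ) (A E : Type) where
  dom : Set (Jet n A)
  isOpen_dom : IsOpen dom
  eqn : E → Jet n A → ℝ
  isDiffFun_eqn : ∀ e, IsDiffFun dom (eqn e)

namespace DESystem

variable {n : ℕ} {A E : Type} (L : DESystem n A E)

/-- `w` is a smooth local solution of `L` on the open set `U`. -/
def IsSolutionOn (U : Set (Fin n → ℝ)) (w : A → (Fin n → ℝ) → ℝ) : Prop :=
  IsOpen U ∧ (∀ a, ContDiffOn ℝ ∞ (w a) U) ∧
    ∀ x ∈ U, jetOf w x ∈ L.dom ∧ ∀ e, L.eqn e (jetOf w x) = 0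

/-- `f` vanishes on all local solutions of `L`, i.e. `f|_L = 0`. -/
def VanishesOnSolutions (f : Jet n A → ℝ) : Prop :=
  ∀ U w, L.IsSolutionOn U w → ∀ x ∈ U, f (jetOf w x) = 0

/-- The space `CV(L)` of conserved vectors. -/
def CV : Submodule ℝ (Fin n → Jet n A → ℝ) where
  carrier := {F | (∀ i, IsDiffFun L.dom (F i)) ∧ L.VanishesOnSolutions (totalDiv F)}
  add_mem' := by
    rintro F G ⟨hF, hF'⟩ ⟨hG, hG'⟩
    refine ⟨fun i => (hF i).add (hG i), fun U w hw x hx => ?_⟩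
    rw [totalDiv_add L.isOpen_dom hF hG (hw.2.2 x hx).1, hF' U w hw x hx, hG' U w hw x hx, add_zero]
  zero_mem' := by
    refine ⟨fun i => IsDiffFun.zero _, fun U w hw x hx => ?_⟩
    simpa using totalDiv_smul (0 : ℝ) (0 : Fin n → Jet n A → ℝ) (jetOf w x)
  smul_mem' := by
    rintro c F ⟨hF, hF'⟩
    refine ⟨fun i => (hF i).smul c, fun U w hw x hx => ?_⟩
    rw [totalDiv_smul, hF' U w hw x hx, mul_zero]

/-- Tuples of differential functions that vanish on the solutions of `L`. -/
def vanishingTuples : Submodule ℝ (Fin n → Jet n A → ℝ) where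
  carrier := {F | ∀ i, IsDiffFun L.dom (F i) ∧ L.VanishesOnSolutions (F i)}
  add_mem' := by
    intro F G hF hG i
    refine ⟨(hF i).1.add (hG i).1, fun U w hw x hx => ?_⟩
    simp [(hF i).2 U w hw x hx, (hG i).2 U w hw x hx]
  zero_mem' := fun i => ⟨IsDiffFun.zero _, fun U w hw x hx => rfl⟩
  smul_mem' := by
    intro c F hF i
    refine ⟨(hF i).1.smul c, fun U w hw x hx => ?_⟩
    simp [(hF i).2 U w hw x hx]

/-- Null divergences: tuples of differential functions whose total divergence vanishes
identically (on the domain under consideration). -/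
def nullDivergences : Submodule ℝ (Fin n → Jet n A → ℝ) where
  carrier := {F | (∀ i, IsDiffFun L.dom (F i)) ∧ ∀ z ∈ L.dom, totalDiv F z = 0}
  add_mem' := by
    rintro F G ⟨hF, hF'⟩ ⟨hG, hG'⟩
    refine ⟨fun i => (hF i).add (hG i), fun z hz => ?_⟩
    rw [totalDiv_add L.isOpen_dom hF hG hz, hF' z hz, hG' z hz, add_zero]
  zero_mem' := by
    refine ⟨fun i => IsDiffFun.zero _, fun z hz => ?_⟩
    simpa using totalDiv_smul (0 : ℝ) (0 : Fin n → Jet n A → ℝ) z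
  smul_mem' := by
    rintro c F ⟨hF, hF'⟩
    refine ⟨fun i => (hF i).smul c, fun z hz => ?_⟩
    rw [totalDiv_smul, hF' z hz, mul_zero]

/-- The space `CV₀(L)` of trivial conserved vectors: sums `F̂ + F̌` of a tuple `F̂` vanishing on
the solutions and a null divergence `F̌`. -/
def CV₀ : Submodule ℝ (Fin n → Jet n A → ℝ) := L.vanishingTuples ⊔ L.nullDivergences

/-- The space of conservation laws `CL(L) = CV(L) / CV₀(L)`. -/
abbrev CL : Type := L.CV ⧸ L.CV₀.submoduleOf L.CV

/-- `F` is a conserved vector of the conservation law `𝓕`. -/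
def IsConservedVectorOf (F : Fin n → Jet n A → ℝ) (𝓕 : L.CL) : Prop :=
  ∃ hF : F ∈ L.CV, Submodule.Quotient.mk ⟨F, hF⟩ = 𝓕

/-- The tuple `lam` of differential functions is a characteristic of the conservation law `𝓕`:
`Div F = lam^μ L^μ` identically, for some conserved vector `F` of `𝓕`. -/
def IsCharacteristicOf [Fintype E] (lam : E → Jet n A → ℝ) (𝓕 : L.CL) : Prop :=
  (∀ e, IsDiffFun L.dom (lam e)) ∧ ∃ F, L.IsConservedVectorOf F 𝓕 ∧
    ∀ z ∈ L.dom, totalDiv F z = ∑ e, lam e z * L.eqn e z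

end DESystem

/-! ### Systems determining Abelian coverings -/

/-- The projection `J^∞(x|u,v) → J^∞(x|u)`. -/
def jetProj {n : ℕ} {A B : Type} (z : Jet n (A ⊕ B)) : Jet n A :=
  Sum.elim (fun i => z (Sum.inl i)) (fun q => z (Sum.inr (Sum.inl q.1, q.2)))

theorem IsDiffFun.comp_jetProj {n : ℕ} {A B : Type} {Ω₀ : Set (Jet n A)}
    {Ω : Set (Jet n (A ⊕ B))} (h : ∀ z ∈ Ω, jetProj z ∈ Ω₀) {f : Jet n A → ℝ}
    (hf : IsDiffFun Ω₀ f) : IsDiffFun Ω (fun z => f (jetProj z)) := by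
  classical
  obtain ⟨S, g, hg, hfe⟩ := hf
  let e : JetVar n A → JetVar n (A ⊕ B) := Sum.map id (Prod.map Sum.inl id)
  have he : ∀ (z : Jet n (A ⊕ B)) q, jetProj z q = z (e q) := by
    rintro z (i | q) <;> rfl
  refine ⟨S.image e, fun y => g (fun s => y ⟨e s.1, Finset.mem_image_of_mem e s.2⟩), ?_, ?_⟩
  · refine hg.comp (ContDiff.contDiffOn (by fun_prop)) ?_
    rintro _ ⟨z, hz, rfl⟩
    exact ⟨jetProj z, h z hz, funext fun s => he z s.1⟩
  · intro z hz
    refine (hfe _ (h z hz)).trans ?_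
    refine congrArg g ?_
    exact funext fun s => he z s.1

/-- The data of a potential system over a system `base` for `u = (u^1,…,u^m)`: right-hand sides
`G^{si}[u]` of the equations `v^s_i = G^{si}` for potentials `v^1,…,v^p`, the set `N` of
the numbers of those equations of `base` that are kept, and an open domain `dom` in
`J^∞(x|u,v)`, lying over the domain of `base`, on which differential functions of `(u,v)` are
considered. -/
structure PotentialFrame (n m p l : ℕ) where
  base : DESystem n (Fin m) (Fin l)
  G : Fin p → Fin n → Jet n (Fin m) → ℝ
  isDiffFun_G : ∀ s i, IsDiffFun base.dom (G s i)
  N : Finset (Fin l)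
  dom : Set (Jet n (Fin m ⊕ Fin p))
  isOpen_dom : IsOpen dom
  proj_mem : ∀ z ∈ dom, jetProj z ∈ base.dom

/-- The jet coordinate `v^s_α`. -/
def potVar {n m p : ℕ} (s : Fin p) (α : Fin n → ℕ) : JetVar n (Fin m ⊕ Fin p) :=
  Sum.inr (Sum.inr s, α)

/-- The system consisting of the equations `ε (v^s_i - G^{si}) = 0` (indexed by `Sum.inl (s, i)`)
and `L^ν = 0`, `ν ∈ N` (indexed by `Sum.inr ν`). The sign `ε = 1` or `ε = -1` fixes whether the
left-hand sides of the potential equations are `v^s_i - G^{si}` or `G^{si} - v^s_i`. -/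
def PotentialFrame.system {n m p l : ℕ} (P : PotentialFrame n m p l) (ε : ℤˣ) :
    DESystem n (Fin m ⊕ Fin p) ((Fin p × Fin n) ⊕ P.N) where
  dom := P.dom
  isOpen_dom := P.isOpen_dom
  eqn := Sum.elim
    (fun q z => ((ε : ℤ) : ℝ) * (z (potVar q.1 (unitIndex q.2)) - P.G q.1 q.2 (jetProj z)))
    (fun ν z => P.base.eqn ν (jetProj z))
  isDiffFun_eqn := by
    rintro (⟨s, i⟩ | ν)
    · have h := ((IsDiffFun.coord P.dom (potVar s (unitIndex i))).add
        ((IsDiffFun.comp_jetProj P.proj_mem (P.isDiffFun_G s i)).smul (-1))).smul ((ε : ℤ) : ℝ)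
      convert h using 1
      funext z
      simp [sub_eq_add_neg]
    · exact IsDiffFun.comp_jetProj P.proj_mem (P.base.isDiffFun_eqn ν)

/-- A potential frame determining an Abelian covering of `base`: the right-hand sides `G^{si}`
do not involve the potentials and are compatible on the solutions of `base`, and every equation of
`base` is a consequence of the system formed by the potential equations and the kept equations. -/
structure AbelianCovering (n m p l : ℕ) extends PotentialFrame n m p l where
  compat : ∀ s i j, base.VanishesOnSolutions
    (fun z => totalDeriv j (G s i) z - totalDeriv i (G s j) z)
  base_eqn : ∀ μ, (toPotentialFrame.system 1).VanishesOnSolutions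
    (fun z => base.eqn μ (jetProj z))

end

noncomputable section

/-! ### Calculus of differential functions -/

/-! The proof applies the Euler operator of the potential `v^s`, that is `E = Σ_α (-D)^α ∂/∂v^s_α`,
to the identity `Div F = λ·L` that defines a characteristic. The left-hand side is annihilated:
`∂/∂v^s_{α+δ_i}` and `D_i` commute up to the term `∂/∂v^s_α`, which makes the sum telescope
(`euler_totalDiv`).

On the right-hand side, the equations involve the potentials only through the first derivatives
`v^σ_i`, linearly with coefficient `ε`. Hence `∂(λ·L)/∂v^s_α` is `c_α = (∂λ/∂v^s_α)·L`, plus `ε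
λ^{si}` when `α = δ_i`. Every `c_α` vanishes on solutions. For `α ≠ 0` the term `(-D)^α c_α` is
`D_i` of something that again vanishes on solutions, because total derivatives preserve vanishing on
solutions (`DESystem.VanishesOnSolutions.totalDeriv`). So `Div (ε λ^s + H) = c_0 = λ_{v^s}·L` with
`H` zero on solutions (`DESystem.exists_totalDiv_add_eq`).

Multiplication by `ε`, with `ε² = 1`, shows that `ε λ_{v^s}` is the characteristic of `λ^s + ε H`,
which is equivalent to `λ^s`. The law is unique because conserved vectors with equal characteristics
differ by a null divergence.

The summation by parts is linear algebra of commuting endomorphisms `T_i = -D_i`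
(`multiPowSum_mapDomain`, `exists_sum_of_multiPowSum_eq_zero`). The calculus before it supplies the
commutation relations by reduction to finitely many coordinates. -/

theorem isOpenMap_finset_restrict {X : Type} (S : Finset X) :
    IsOpenMap (S.restrict : (X → ℝ) → (S → ℝ)) := by
  classical
  intro V hV
  rw [isOpen_iff_forall_mem_open]
  rintro _ ⟨y, hy, rfl⟩
  -- A continuous section of the restriction through `y`: coordinates outside `S` are frozen at
  -- those of `y`.
  let e : (S → ℝ) → X → ℝ := fun b q => if h : q ∈ S then b ⟨q, h⟩ else y q
  have he : Continuous e := by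
    refine continuous_pi fun q => ?_
    by_cases h : q ∈ S
    · simpa [e, h] using continuous_apply _
    · simpa [e, h] using continuous_const
  have hey : e (S.restrict y) = y := by
    ext q
    by_cases h : q ∈ S <;> simp [e, h]
  refine ⟨e ⁻¹' V, fun b hb => ⟨e b, hb, ?_⟩, hV.preimage he, by simpa [hey] using hy⟩
  ext s
  simp [e]

@[simp]
theorem setCoord_self {n : ℕ} {A : Type} (z : Jet n A) (q : JetVar n A) :
    setCoord z q (z q) = z := by
  funext r
  by_cases h : r = q <;> simp [setCoord, h]

theorem continuous_setCoord {n : ℕ} {A : Type} (z : Jet n A) (q : JetVar n A) :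
    Continuous fun t => setCoord z q t := by
  refine continuous_pi fun r => ?_
  by_cases h : r = q
  · simpa [setCoord, h] using continuous_id'
  · simpa [setCoord, h] using continuous_const

theorem eventually_setCoord_mem {n : ℕ} {A : Type} {Ω : Set (Jet n A)} (hΩ : IsOpen Ω)
    {z : Jet n A} (hz : z ∈ Ω) (q : JetVar n A) :
    ∀ᶠ t in nhds (z q), setCoord z q t ∈ Ω :=
  (continuous_setCoord z q).continuousAt.eventually_mem (hΩ.mem_nhds (by rwa [setCoord_self]))

/-- Differentiation is local and `Ω` is open, so values off `Ω` never matter. -/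
theorem jetPartial_congr {n : ℕ} {A : Type} {Ω : Set (Jet n A)} (hΩ : IsOpen Ω)
    {f g : Jet n A → ℝ} (h : Set.EqOn f g Ω) (q : JetVar n A) :
    Set.EqOn (jetPartial q f) (jetPartial q g) Ω := fun z hz =>
  Filter.EventuallyEq.deriv_eq <| by
    filter_upwards [eventually_setCoord_mem hΩ hz q] with t ht using h ht

theorem totalDeriv_congr {n : ℕ} {A : Type} {Ω : Set (Jet n A)} (hΩ : IsOpen Ω)
    {f g : Jet n A → ℝ} (h : Set.EqOn f g Ω) (i : Fin n) :
    Set.EqOn (totalDeriv i f) (totalDeriv i g) Ω := fun z hz => by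
  simp only [totalDeriv, jetPartial_congr hΩ h _ hz]

theorem IsDiffFun.congr {n : ℕ} {A : Type} {Ω : Set (Jet n A)} {f g : Jet n A → ℝ}
    (hf : IsDiffFun Ω f) (h : Set.EqOn g f Ω) : IsDiffFun Ω g := by
  obtain ⟨S, f', hf', hfe⟩ := hf
  exact ⟨S, f', hf', fun z hz => (h hz).trans (hfe z hz)⟩

theorem IsDiffFun.mul {n : ℕ} {A : Type} {Ω : Set (Jet n A)} {f g : Jet n A → ℝ}
    (hf : IsDiffFun Ω f) (hg : IsDiffFun Ω g) : IsDiffFun Ω (f * g) := by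
  classical
  obtain ⟨S, f', hf', hfe⟩ := hf
  obtain ⟨T, g', hg', hge⟩ := hg
  refine ⟨S ∪ T, _, (IsDiffFun.mono_finset Finset.subset_union_left hf').mul
    (IsDiffFun.mono_finset Finset.subset_union_right hg'), ?_⟩
  intro z hz
  simp only [Pi.mul_apply, hfe z hz, hge z hz]
  rfl

theorem IsDiffFun.const {n : ℕ} {A : Type} (Ω : Set (Jet n A)) (c : ℝ) :
    IsDiffFun Ω (fun _ => c) :=
  ⟨∅, fun _ => c, contDiffOn_const, fun _ _ => rfl⟩

theorem IsDiffFun.sum {n : ℕ} {A X : Type} {Ω : Set (Jet n A)} {f : X → Jet n A → ℝ}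
    (s : Finset X) (hf : ∀ r, IsDiffFun Ω (f r)) : IsDiffFun Ω (∑ r ∈ s, f r) :=
  Finset.sum_induction f (IsDiffFun Ω) (fun _ _ => IsDiffFun.add) (IsDiffFun.zero Ω)
    fun r _ => hf r

open Classical in
/-- The restriction to finitely many coordinates of the jet coordinate vector along `q`. -/
def coordDir {n : ℕ} {A : Type} (S : Finset (JetVar n A)) (q : JetVar n A) : S → ℝ :=
  fun s => if s.1 = q then 1 else 0

theorem coordDir_of_notMem {n : ℕ} {A : Type} {S : Finset (JetVar n A)} {q : JetVar n A}
    (h : q ∉ S) : coordDir S q = 0 := by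
  funext s
  exact if_neg fun hs : s.1 = q => h (hs ▸ s.2)

/-- The bridge to finite-dimensional calculus: smoothness and symmetry of jet partials are inherited
from the representing function `g`. For `q ∉ S` the direction is zero. -/
theorem jetPartial_eq_fderiv {n : ℕ} {A : Type} {Ω : Set (Jet n A)} (hΩ : IsOpen Ω)
    {f : Jet n A → ℝ} {S : Finset (JetVar n A)} {g : (S → ℝ) → ℝ}
    (hg : ContDiffOn ℝ ∞ g (S.restrict '' Ω)) (hfg : ∀ z ∈ Ω, f z = g (S.restrict z))
    (q : JetVar n A) {z : Jet n A} (hz : z ∈ Ω) :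
    jetPartial q f z = fderiv ℝ g (S.restrict z) (coordDir S q) := by
  rw [jetPartial_congr hΩ (g := fun z => g (S.restrict z)) hfg q hz]
  have hgd : HasFDerivAt g (fderiv ℝ g (S.restrict z)) (S.restrict (setCoord z q (z q))) := by
    rw [setCoord_self]
    exact ((hg.contDiffAt ((isOpenMap_finset_restrict S Ω hΩ).mem_nhds
      ⟨z, hz, rfl⟩)).differentiableAt (by simp)).hasFDerivAt
  have hc : HasDerivAt (fun t => S.restrict (setCoord z q t)) (coordDir S q) (z q) := by
    rw [hasDerivAt_pi]
    intro s
    by_cases h : s.1 = q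
    · simpa [setCoord, coordDir, h] using hasDerivAt_id' _
    · simpa [setCoord, coordDir, h] using hasDerivAt_const _ _
  exact (hgd.comp_hasDerivAt (z q) hc).deriv

theorem IsDiffFun.jetPartial {n : ℕ} {A : Type} {Ω : Set (Jet n A)} (hΩ : IsOpen Ω)
    {f : Jet n A → ℝ} (hf : IsDiffFun Ω f) (q : JetVar n A) :
    IsDiffFun Ω (jetPartial q f) := by
  obtain ⟨S, g, hg, hfg⟩ := hf
  refine ⟨S, fun y => fderiv ℝ g y (coordDir S q), ?_,
    fun z hz => jetPartial_eq_fderiv hΩ hg hfg q hz⟩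
  exact (hg.fderiv_of_isOpen (isOpenMap_finset_restrict S Ω hΩ) (m := ∞) (by simp)).clm_apply
    contDiffOn_const

theorem jetPartial_comm {n : ℕ} {A : Type} {Ω : Set (Jet n A)} (hΩ : IsOpen Ω)
    {f : Jet n A → ℝ} (hf : IsDiffFun Ω f) (q r : JetVar n A) {z : Jet n A} (hz : z ∈ Ω) :
    jetPartial q (jetPartial r f) z = jetPartial r (jetPartial q f) z := by
  obtain ⟨S, g, hg, hfg⟩ := hf
  have hS := isOpenMap_finset_restrict S Ω hΩ
  have hfd : ContDiffOn ℝ ∞ (fderiv ℝ g) (S.restrict '' Ω) := hg.fderiv_of_isOpen hS (by simp)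
  have hmem : S.restrict '' Ω ∈ nhds (S.restrict z) := hS.mem_nhds ⟨z, hz, rfl⟩
  have key : ∀ q r, jetPartial q (_root_.jetPartial r f) z =
      fderiv ℝ (fderiv ℝ g) (S.restrict z) (coordDir S q) (coordDir S r) := by
    intro q r
    rw [jetPartial_eq_fderiv hΩ (hfd.clm_apply contDiffOn_const)
      (fun z hz => jetPartial_eq_fderiv hΩ hg hfg r hz) q hz]
    rw [fderiv_clm_apply ((hfd.contDiffAt hmem).differentiableAt (by simp))
      (differentiableAt_const _)]
    simp
  rw [key, key]
  exact ((hg.contDiffAt hmem).isSymmSndFDerivAt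
    (by simpa using WithTop.coe_le_coe.2 (le_top : (2 : ℕ∞) ≤ ⊤))).eq _ _

theorem IsDiffFun.exists_finset {n : ℕ} {A : Type} {Ω : Set (Jet n A)} (hΩ : IsOpen Ω)
    {f : Jet n A → ℝ} (hf : IsDiffFun Ω f) :
    ∃ S : Finset (JetVar n A), ∀ q ∉ S, Set.EqOn (_root_.jetPartial q f) 0 Ω := by
  obtain ⟨S, g, hg, hfg⟩ := hf
  refine ⟨S, fun q hq z hz => ?_⟩
  rw [jetPartial_eq_fderiv hΩ hg hfg q hz, coordDir_of_notMem hq]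
  simp

theorem jetPartial_zero {n : ℕ} {A : Type} (q : JetVar n A) :
    jetPartial q (0 : Jet n A → ℝ) = 0 := by
  funext z
  simp [jetPartial]

theorem jetPartial_const {n : ℕ} {A : Type} (q : JetVar n A) (c : ℝ) :
    jetPartial q (fun _ : Jet n A => c) = 0 := by
  funext z
  simp [jetPartial]

open Classical in
theorem jetPartial_coord {n : ℕ} {A : Type} (q r : JetVar n A) (z : Jet n A) :
    jetPartial q (fun z => z r) z = if r = q then 1 else 0 := by
  by_cases h : r = q <;> simp [jetPartial, setCoord, h]

theorem jetPartial_add {n : ℕ} {A : Type} {Ω : Set (Jet n A)} (hΩ : IsOpen Ω)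
    {f g : Jet n A → ℝ} (hf : IsDiffFun Ω f) (hg : IsDiffFun Ω g) (q : JetVar n A) {z : Jet n A}
    (hz : z ∈ Ω) : jetPartial q (f + g) z = jetPartial q f z + jetPartial q g z :=
  deriv_add ((hf.partials hΩ hz).1 q) ((hg.partials hΩ hz).1 q)

theorem jetPartial_mul {n : ℕ} {A : Type} {Ω : Set (Jet n A)} (hΩ : IsOpen Ω)
    {f g : Jet n A → ℝ} (hf : IsDiffFun Ω f) (hg : IsDiffFun Ω g) (q : JetVar n A) {z : Jet n A}
    (hz : z ∈ Ω) :
    jetPartial q (f * g) z = jetPartial q f z * g z + f z * jetPartial q g z := by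
  have h := deriv_mul ((hf.partials hΩ hz).1 q) ((hg.partials hΩ hz).1 q)
  rw [setCoord_self] at h
  exact h

theorem jetPartial_sum {n : ℕ} {A X : Type} {Ω : Set (Jet n A)} (hΩ : IsOpen Ω)
    {f : X → Jet n A → ℝ} (s : Finset X) (hf : ∀ r, IsDiffFun Ω (f r)) (q : JetVar n A)
    {z : Jet n A} (hz : z ∈ Ω) :
    jetPartial q (∑ r ∈ s, f r) z = ∑ r ∈ s, jetPartial q (f r) z := by
  classical
  induction s using Finset.induction_on with
  | empty => simp [jetPartial_zero]
  | insert a s ha ih =>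
    rw [Finset.sum_insert ha, Finset.sum_insert ha,
      jetPartial_add hΩ (hf a) (IsDiffFun.sum s hf) q hz, ih]

/-- The coefficient of `∂/∂q` in the total derivative `D_i`, i.e. `D_i q`. -/
def totalCoeff {n : ℕ} {A : Type} (i : Fin n) : JetVar n A → Jet n A → ℝ :=
  Sum.elim (fun j _ => if j = i then 1 else 0) (fun q z => z (Sum.inr (q.1, q.2 + unitIndex i)))

theorem IsDiffFun.totalCoeff {n : ℕ} {A : Type} (Ω : Set (Jet n A)) (i : Fin n)
    (q : JetVar n A) : IsDiffFun Ω (totalCoeff i q) := by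
  rcases q with j | q
  · exact IsDiffFun.const Ω _
  · exact IsDiffFun.coord Ω _

/-- Any finite set containing all relevant coordinates will do, so several functions can share one
`S`. The `x_i` term is absorbed by treating all coordinates alike through `totalCoeff`. -/
theorem totalDeriv_eq_sum {n : ℕ} {A : Type} {S : Finset (JetVar n A)} {f : Jet n A → ℝ}
    {z : Jet n A} (hS : ∀ q ∉ S, jetPartial q f z = 0) (i : Fin n) :
    totalDeriv i f z = ∑ q ∈ S, totalCoeff i q z * jetPartial q f z := by
  classical
  rw [← Finset.toLeft_disjSum_toRight (u := S), Finset.sum_disjSum, totalDeriv]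
  congr 1
  · simp only [totalCoeff, Sum.elim_inl, ite_mul, one_mul, zero_mul, Finset.sum_ite_eq',
      Finset.mem_toLeft]
    split_ifs with h
    · rfl
    · exact hS _ h
  · refine finsum_eq_sum_of_support_subset _ fun q hq => ?_
    by_contra h
    exact hq (by simp [hS (Sum.inr q) (by simpa using h)])

theorem IsDiffFun.totalDeriv {n : ℕ} {A : Type} {Ω : Set (Jet n A)} (hΩ : IsOpen Ω)
    {f : Jet n A → ℝ} (hf : IsDiffFun Ω f) (i : Fin n) : IsDiffFun Ω (totalDeriv i f) := by
  obtain ⟨S, hS⟩ := hf.exists_finset hΩ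
  refine (IsDiffFun.sum S fun q => (IsDiffFun.totalCoeff Ω i q).mul (hf.jetPartial hΩ q)).congr
    fun z hz => ?_
  rw [totalDeriv_eq_sum (fun q hq => hS q hq hz) i]
  simp

theorem IsDiffFun.totalDiv {n : ℕ} {A : Type} {Ω : Set (Jet n A)} (hΩ : IsOpen Ω)
    {F : Fin n → Jet n A → ℝ} (hF : ∀ i, IsDiffFun Ω (F i)) : IsDiffFun Ω (totalDiv F) :=
  (IsDiffFun.sum Finset.univ fun i => (hF i).totalDeriv hΩ i).congr fun z _ => by
    simp [_root_.totalDiv]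

theorem totalDeriv_mul {n : ℕ} {A : Type} {Ω : Set (Jet n A)} (hΩ : IsOpen Ω)
    {f g : Jet n A → ℝ} (hf : IsDiffFun Ω f) (hg : IsDiffFun Ω g) (i : Fin n) {z : Jet n A}
    (hz : z ∈ Ω) :
    totalDeriv i (f * g) z = totalDeriv i f z * g z + f z * totalDeriv i g z := by
  classical
  obtain ⟨S, hS⟩ := hf.exists_finset hΩ
  obtain ⟨T, hT⟩ := hg.exists_finset hΩ
  have hS' : ∀ q ∉ S ∪ T, jetPartial q f z = 0 := fun q hq =>
    hS q (fun h => hq (Finset.mem_union_left _ h)) hz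
  have hT' : ∀ q ∉ S ∪ T, jetPartial q g z = 0 := fun q hq =>
    hT q (fun h => hq (Finset.mem_union_right _ h)) hz
  rw [totalDeriv_eq_sum hS', totalDeriv_eq_sum hT', totalDeriv_eq_sum (S := S ∪ T)
    (fun q hq => by rw [jetPartial_mul hΩ hf hg q hz, hS' q hq, hT' q hq]; simp),
    Finset.sum_mul, Finset.mul_sum, ← Finset.sum_add_distrib]
  refine Finset.sum_congr rfl fun q _ => ?_
  rw [jetPartial_mul hΩ hf hg q hz]
  ring

theorem totalDeriv_sum {n : ℕ} {A X : Type} {Ω : Set (Jet n A)} (hΩ : IsOpen Ω)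
    {f : X → Jet n A → ℝ} (s : Finset X) (hf : ∀ r, IsDiffFun Ω (f r)) (i : Fin n)
    {z : Jet n A} (hz : z ∈ Ω) :
    totalDeriv i (∑ r ∈ s, f r) z = ∑ r ∈ s, totalDeriv i (f r) z := by
  classical
  induction s using Finset.induction_on with
  | empty => simpa using totalDeriv_smul (0 : ℝ) (0 : Jet n A → ℝ) i z
  | insert a s ha ih =>
    rw [Finset.sum_insert ha, Finset.sum_insert ha,
      totalDeriv_add hΩ (hf a) (IsDiffFun.sum s hf) i hz, ih]

theorem totalDeriv_coord {n : ℕ} {A : Type} (i : Fin n) (r : JetVar n A) (z : Jet n A) :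
    totalDeriv i (fun z => z r) z = totalCoeff i r z := by
  classical
  rw [totalDeriv_eq_sum (S := {r})
    (fun q hq => by rw [jetPartial_coord, if_neg (by simpa [eq_comm] using hq)])]
  simp [jetPartial_coord]

/-! ### Commutation relations of total and partial derivatives. -/

theorem totalDeriv_totalCoeff_comm {n : ℕ} {A : Type} (i j : Fin n) (r : JetVar n A)
    (z : Jet n A) : totalDeriv i (totalCoeff j r) z = totalDeriv j (totalCoeff i r) z := by
  rcases r with k | ⟨a, α⟩
  · have h : ∀ (i : Fin n) (c : ℝ), totalDeriv i (fun _ : Jet n A => c) z = 0 := fun i c => by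
      simp [totalDeriv, jetPartial_const]
    exact (h i _).trans (h j _).symm
  · refine (totalDeriv_coord i _ z).trans (Eq.trans ?_ (totalDeriv_coord j _ z).symm)
    simp [totalCoeff, add_right_comm]

theorem totalDeriv_comm {n : ℕ} {A : Type} {Ω : Set (Jet n A)} (hΩ : IsOpen Ω)
    {f : Jet n A → ℝ} (hf : IsDiffFun Ω f) (i j : Fin n) {z : Jet n A} (hz : z ∈ Ω) :
    totalDeriv i (totalDeriv j f) z = totalDeriv j (totalDeriv i f) z := by
  obtain ⟨S, hS⟩ := hf.exists_finset hΩ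
  -- The second-order part is a double sum, symmetric in `i, j` after renaming indices; the
  -- first-order part is symmetric because `D_i D_j r = D_j D_i r` for each coordinate `r`.
  have key : ∀ i j, totalDeriv i (totalDeriv j f) z =
      ∑ r ∈ S, totalDeriv i (totalCoeff j r) z * jetPartial r f z +
        ∑ r ∈ S, ∑ q ∈ S, totalCoeff j r z * (totalCoeff i q z *
          jetPartial q (jetPartial r f) z) := by
    intro i j
    have h1 : Set.EqOn (totalDeriv j f) (∑ r ∈ S, totalCoeff j r * jetPartial r f) Ω :=
      fun y hy => by
        rw [totalDeriv_eq_sum (fun q hq => hS q hq hy) j]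
        simp
    rw [totalDeriv_congr hΩ h1 i hz, totalDeriv_sum hΩ S
      (fun r => (IsDiffFun.totalCoeff Ω j r).mul (hf.jetPartial hΩ r)) i hz,
      ← Finset.sum_add_distrib]
    refine Finset.sum_congr rfl fun r _ => ?_
    rw [totalDeriv_mul hΩ (IsDiffFun.totalCoeff Ω j r) (hf.jetPartial hΩ r) i hz,
      totalDeriv_eq_sum (S := S) (f := jetPartial r f), Finset.mul_sum]
    intro q hq
    rw [jetPartial_comm hΩ hf q r hz, jetPartial_congr hΩ (hS q hq) r hz, jetPartial_zero]
    rfl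
  rw [key i j, key j i, Finset.sum_comm (s := S) (t := S)]
  simp only [totalDeriv_totalCoeff_comm i j]
  refine congrArg _ (Finset.sum_congr rfl fun r _ => Finset.sum_congr rfl fun q _ => ?_)
  rw [jetPartial_comm hΩ hf r q hz]
  ring

/-- The commutator of `∂/∂q` with `D_i` comes from differentiating the coefficients of `D_i` only.
-/
theorem jetPartial_totalDeriv {n : ℕ} {A : Type} {Ω : Set (Jet n A)} (hΩ : IsOpen Ω)
    {f : Jet n A → ℝ} (hf : IsDiffFun Ω f) {S : Finset (JetVar n A)}
    (hS : ∀ q ∉ S, Set.EqOn (jetPartial q f) 0 Ω) (i : Fin n) (q : JetVar n A) {z : Jet n A}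
    (hz : z ∈ Ω) :
    jetPartial q (totalDeriv i f) z = totalDeriv i (jetPartial q f) z +
      ∑ r ∈ S, jetPartial q (totalCoeff i r) z * jetPartial r f z := by
  have h1 : Set.EqOn (totalDeriv i f) (∑ r ∈ S, totalCoeff i r * jetPartial r f) Ω :=
    fun y hy => by
      rw [totalDeriv_eq_sum (fun q hq => hS q hq hy) i]
      simp
  rw [jetPartial_congr hΩ h1 q hz, jetPartial_sum hΩ S
    (fun r => (IsDiffFun.totalCoeff Ω i r).mul (hf.jetPartial hΩ r)) q hz,
    totalDeriv_eq_sum (S := S) (f := jetPartial q f), ← Finset.sum_add_distrib]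
  · refine Finset.sum_congr rfl fun r _ => ?_
    rw [jetPartial_mul hΩ (IsDiffFun.totalCoeff Ω i r) (hf.jetPartial hΩ r) q hz,
      jetPartial_comm hΩ hf q r hz]
    ring
  · intro r hr
    rw [jetPartial_comm hΩ hf r q hz, jetPartial_congr hΩ (hS r hr) q hz, jetPartial_zero]
    rfl

theorem jetPartial_totalDeriv_add {n : ℕ} {A : Type} {Ω : Set (Jet n A)} (hΩ : IsOpen Ω)
    {f : Jet n A → ℝ} (hf : IsDiffFun Ω f) (i : Fin n) (a : A) (α : Fin n → ℕ) {z : Jet n A}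
    (hz : z ∈ Ω) :
    jetPartial (Sum.inr (a, α + unitIndex i)) (totalDeriv i f) z =
      totalDeriv i (jetPartial (Sum.inr (a, α + unitIndex i)) f) z +
        jetPartial (Sum.inr (a, α)) f z := by
  classical
  obtain ⟨S, hS⟩ := hf.exists_finset hΩ
  rw [jetPartial_totalDeriv hΩ hf hS i _ hz]
  congr 1
  -- The coordinate `u^a_{α+δ_i}` is the coefficient of `∂/∂u^a_α` in `D_i` and of no other
  -- derivation.
  rw [Finset.sum_eq_single (Sum.inr (a, α))]
  · have := jetPartial_coord (Sum.inr (a, α + unitIndex i)) (Sum.inr (a, α + unitIndex i)) z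
    rw [if_pos rfl] at this
    exact (congrArg (· * _) this).trans (one_mul _)
  · rintro (k | ⟨b, β⟩) _ hne
    · refine (congrArg (· * _) (congrFun (jetPartial_const _ _) z)).trans (zero_mul _)
    · refine (congrArg (· * _) ((jetPartial_coord _ _ z).trans (if_neg ?_))).trans (zero_mul _)
      simpa using hne
  · intro h
    simp [hS _ h hz]

theorem jetPartial_totalDeriv_of_notMem_range {n : ℕ} {A : Type} {Ω : Set (Jet n A)}
    (hΩ : IsOpen Ω) {f : Jet n A → ℝ} (hf : IsDiffFun Ω f) (i : Fin n) (a : A)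
    {α : Fin n → ℕ} (hα : α ∉ Set.range (· + unitIndex i)) {z : Jet n A} (hz : z ∈ Ω) :
    jetPartial (Sum.inr (a, α)) (totalDeriv i f) z =
      totalDeriv i (jetPartial (Sum.inr (a, α)) f) z := by
  classical
  obtain ⟨S, hS⟩ := hf.exists_finset hΩ
  rw [jetPartial_totalDeriv hΩ hf hS i _ hz, Finset.sum_eq_zero, add_zero]
  rintro (k | ⟨b, β⟩) _
  · refine (congrArg (· * _) (congrFun (jetPartial_const _ _) z)).trans (zero_mul _)
  · refine (congrArg (· * _) ((jetPartial_coord _ _ z).trans (if_neg ?_))).trans (zero_mul _)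
    intro h
    simp only [Sum.inr.injEq, Prod.mk.injEq] at h
    exact hα ⟨β, h.2⟩

/-! ### Total derivatives along solutions -/

theorem partialX_congr {n : ℕ} {U : Set (Fin n → ℝ)} (hU : IsOpen U) {f g : (Fin n → ℝ) → ℝ}
    (h : Set.EqOn f g U) (i : Fin n) : Set.EqOn (partialX i f) (partialX i g) U := fun x hx => by
  rw [partialX, partialX,
    Filter.EventuallyEq.fderiv_eq (Filter.eventuallyEq_of_mem (hU.mem_nhds hx) h)]

theorem ContDiffOn.partialX {n : ℕ} {U : Set (Fin n → ℝ)} (hU : IsOpen U)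
    {f : (Fin n → ℝ) → ℝ} (hf : ContDiffOn ℝ ∞ f U) (i : Fin n) :
    ContDiffOn ℝ ∞ (partialX i f) U :=
  (hf.fderiv_of_isOpen hU (m := ∞) (by simp)).clm_apply contDiffOn_const

theorem partialX_comm {n : ℕ} {U : Set (Fin n → ℝ)} (hU : IsOpen U) {f : (Fin n → ℝ) → ℝ}
    (hf : ContDiffOn ℝ ∞ f U) (i j : Fin n) :
    Set.EqOn (partialX i (partialX j f)) (partialX j (partialX i f)) U := by
  intro x hx
  have hfd : DifferentiableAt ℝ (fderiv ℝ f) x :=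
    ((hf.fderiv_of_isOpen hU (m := ∞) (by simp)).contDiffAt
      (hU.mem_nhds hx)).differentiableAt (by simp)
  have key : ∀ i j, partialX i (_root_.partialX j f) x =
      fderiv ℝ (fderiv ℝ f) x (Pi.single i 1) (Pi.single j 1) := by
    intro i j
    unfold _root_.partialX
    rw [fderiv_clm_apply hfd (differentiableAt_const _)]
    simp
  rw [key, key]
  exact ((hf.contDiffAt (hU.mem_nhds hx)).isSymmSndFDerivAt
    (by simpa using WithTop.coe_le_coe.2 (le_top : (2 : ℕ∞) ≤ ⊤))).eq _ _

theorem ContDiffOn.iterate_partialX {n : ℕ} {U : Set (Fin n → ℝ)} (hU : IsOpen U)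
    {f : (Fin n → ℝ) → ℝ} (hf : ContDiffOn ℝ ∞ f U) (i : Fin n) (k : ℕ) :
    ContDiffOn ℝ ∞ ((_root_.partialX i)^[k] f) U := by
  induction k with
  | zero => exact hf
  | succ k ih =>
    rw [Function.iterate_succ_apply']
    exact ih.partialX hU i

theorem iterate_partialX_congr {n : ℕ} {U : Set (Fin n → ℝ)} (hU : IsOpen U)
    {f g : (Fin n → ℝ) → ℝ} (h : Set.EqOn f g U) (i : Fin n) (k : ℕ) :
    Set.EqOn ((partialX i)^[k] f) ((partialX i)^[k] g) U := by
  induction k with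
  | zero => exact h
  | succ k ih =>
    rw [Function.iterate_succ_apply', Function.iterate_succ_apply']
    exact partialX_congr hU ih i

theorem iterate_partialX_comm {n : ℕ} {U : Set (Fin n → ℝ)} (hU : IsOpen U)
    {f : (Fin n → ℝ) → ℝ} (hf : ContDiffOn ℝ ∞ f U) (i j : Fin n) (k : ℕ) :
    Set.EqOn ((partialX j)^[k] (partialX i f)) (partialX i ((partialX j)^[k] f)) U := by
  induction k with
  | zero => exact Set.eqOn_refl _ _
  | succ k ih =>
    rw [Function.iterate_succ_apply', Function.iterate_succ_apply']
    exact (partialX_congr hU ih j).trans (partialX_comm hU (hf.iterate_partialX hU j k) j i)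

theorem contDiffOn_foldr_partialX {n : ℕ} {U : Set (Fin n → ℝ)} (hU : IsOpen U)
    {f : (Fin n → ℝ) → ℝ} (hf : ContDiffOn ℝ ∞ f U) (α : Fin n → ℕ) (l : List (Fin n)) :
    ContDiffOn ℝ ∞ (l.foldr (fun i h => (partialX i)^[α i] h) f) U := by
  induction l with
  | nil => exact hf
  | cons j l ih => exact ih.iterate_partialX hU j (α j)

/-- The extra `∂_i` appears where the fold meets `i`, exactly once since the list has no
repetitions, and is then commuted outwards past the remaining derivatives. -/
theorem foldr_partialX_add_unitIndex {n : ℕ} {U : Set (Fin n → ℝ)} (hU : IsOpen U)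
    {f : (Fin n → ℝ) → ℝ} (hf : ContDiffOn ℝ ∞ f U) (α : Fin n → ℕ) (i : Fin n)
    {l : List (Fin n)} (hl : l.Nodup) :
    (i ∉ l → l.foldr (fun j h => (partialX j)^[(α + unitIndex i) j] h) f =
      l.foldr (fun j h => (partialX j)^[α j] h) f) ∧
    (i ∈ l → Set.EqOn (l.foldr (fun j h => (partialX j)^[(α + unitIndex i) j] h) f)
      (partialX i (l.foldr (fun j h => (partialX j)^[α j] h) f)) U) := by
  induction l with
  | nil => simp
  | cons j l ih =>
    obtain ⟨hj, hl⟩ := List.nodup_cons.1 hl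
    obtain ⟨ih1, ih2⟩ := ih hl
    have hne : i ≠ j → (α + unitIndex i) j = α j := fun h => by
      simp [unitIndex, Pi.single_eq_of_ne (Ne.symm h)]
    constructor
    · intro hi
      obtain ⟨hij, hi⟩ := not_or.1 (mt List.mem_cons.2 hi)
      simp only [List.foldr_cons]
      rw [hne hij, ih1 hi]
    · intro hi
      simp only [List.foldr_cons]
      by_cases hij : i = j
      · subst hij
        rw [ih1 hj, show (α + unitIndex i) i = α i + 1 by simp [unitIndex],
          Function.iterate_succ_apply']
        exact Set.eqOn_refl _ _
      · rw [hne hij]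
        exact (iterate_partialX_congr hU (ih2 ((List.mem_cons.1 hi).resolve_left hij)) j _).trans
          (iterate_partialX_comm hU (contDiffOn_foldr_partialX hU hf α l) i j _)

theorem mixedPartial_add_unitIndex {n : ℕ} {U : Set (Fin n → ℝ)} (hU : IsOpen U)
    {f : (Fin n → ℝ) → ℝ} (hf : ContDiffOn ℝ ∞ f U) (α : Fin n → ℕ) (i : Fin n) :
    Set.EqOn (mixedPartial (α + unitIndex i) f) (partialX i (mixedPartial α f)) U :=
  (foldr_partialX_add_unitIndex hU hf α i (List.nodup_finRange n)).2 (List.mem_finRange i)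

theorem hasDerivAt_jetOf {n : ℕ} {A : Type} {U : Set (Fin n → ℝ)} (hU : IsOpen U)
    {w : A → (Fin n → ℝ) → ℝ} (hw : ∀ a, ContDiffOn ℝ ∞ (w a) U) (i : Fin n)
    (q : JetVar n A) {x : Fin n → ℝ} (hx : x ∈ U) :
    HasDerivAt (fun t : ℝ => jetOf w (x + t • Pi.single i 1) q) (totalCoeff i q (jetOf w x)) 0 := by
  have hline : HasDerivAt (fun t : ℝ => x + t • (Pi.single i 1 : Fin n → ℝ)) (Pi.single i 1) 0 := by
    simpa using ((hasDerivAt_id (0 : ℝ)).smul_const (Pi.single i 1 : Fin n → ℝ)).const_add x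
  rcases q with j | ⟨a, α⟩
  · have := (hasDerivAt_pi.1 hline) j
    simpa [jetOf, totalCoeff, Pi.single_apply] using this
  · have hd : HasFDerivAt (mixedPartial α (w a)) (fderiv ℝ (mixedPartial α (w a)) x)
        (x + (0 : ℝ) • (Pi.single i 1 : Fin n → ℝ)) := by
      rw [zero_smul, add_zero]
      exact (((contDiffOn_foldr_partialX hU (hw a) α (List.finRange n)).contDiffAt
        (hU.mem_nhds hx)).differentiableAt (by simp)).hasFDerivAt
    have h := hd.comp_hasDerivAt (0 : ℝ) hline
    have he := mixedPartial_add_unitIndex hU (hw a) α i hx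
    simp only [totalCoeff, jetOf, Sum.elim_inr]
    rw [he]
    exact h

/-- The chain rule: along the jet of a smooth tuple, `D_i` is ordinary differentiation in `x_i`. -/
theorem totalDeriv_jetOf {n : ℕ} {A : Type} {Ω : Set (Jet n A)} (hΩ : IsOpen Ω)
    {f : Jet n A → ℝ} (hf : IsDiffFun Ω f) {U : Set (Fin n → ℝ)} (hU : IsOpen U)
    {w : A → (Fin n → ℝ) → ℝ} (hw : ∀ a, ContDiffOn ℝ ∞ (w a) U)
    (hwΩ : ∀ x ∈ U, jetOf w x ∈ Ω) (i : Fin n) {x : Fin n → ℝ} (hx : x ∈ U) :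
    HasDerivAt (fun t : ℝ => f (jetOf w (x + t • Pi.single i 1)))
      (totalDeriv i f (jetOf w x)) 0 := by
  classical
  obtain ⟨S, g, hg, hfg⟩ := hf
  have hgd : HasFDerivAt g (fderiv ℝ g (S.restrict (jetOf w x)))
      (S.restrict (jetOf w (x + (0 : ℝ) • Pi.single i 1))) := by
    rw [zero_smul, add_zero]
    exact ((hg.contDiffAt ((isOpenMap_finset_restrict S Ω hΩ).mem_nhds
      ⟨_, hwΩ x hx, rfl⟩)).differentiableAt (by simp)).hasFDerivAt
  have hc : HasDerivAt (fun t : ℝ => S.restrict (jetOf w (x + t • Pi.single i 1)))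
      (fun s : S => totalCoeff i s.1 (jetOf w x)) 0 :=
    hasDerivAt_pi.2 fun s => hasDerivAt_jetOf hU hw i s.1 hx
  have h := hgd.comp_hasDerivAt (0 : ℝ) hc
  have hval : fderiv ℝ g (S.restrict (jetOf w x)) (fun s : S => totalCoeff i s.1 (jetOf w x)) =
      totalDeriv i f (jetOf w x) := by
    rw [totalDeriv_eq_sum (S := S) (fun q hq => by
      rw [jetPartial_eq_fderiv hΩ hg hfg q (hwΩ x hx), coordDir_of_notMem hq, map_zero])]
    rw [show (fun s : S => totalCoeff i s.1 (jetOf w x)) =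
      ∑ q ∈ S, totalCoeff i q (jetOf w x) • coordDir S q from ?_, map_sum]
    · refine Finset.sum_congr rfl fun q _ => ?_
      rw [map_smul, smul_eq_mul, jetPartial_eq_fderiv hΩ hg hfg q (hwΩ x hx)]
    · funext s
      simp [coordDir, Finset.sum_apply]
  rw [hval] at h
  refine h.congr_of_eventuallyEq ?_
  have hcont : ContinuousAt (fun t : ℝ => x + t • (Pi.single i 1 : Fin n → ℝ)) 0 := by fun_prop
  filter_upwards [hcont.eventually_mem (hU.mem_nhds (by simpa using hx))] with t ht
  exact hfg _ (hwΩ _ ht)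

/-- Restricted to a solution, `f` is zero on an open set of `x`, hence so is its derivative. No
representation of `f` through the equations is needed. -/
theorem DESystem.VanishesOnSolutions.totalDeriv {n : ℕ} {A E : Type} {L : DESystem n A E}
    {f : Jet n A → ℝ} (hf : IsDiffFun L.dom f) (h : L.VanishesOnSolutions f) (i : Fin n) :
    L.VanishesOnSolutions (totalDeriv i f) := by
  intro U w hw x hx
  have h1 := totalDeriv_jetOf L.isOpen_dom hf hw.1 hw.2.1 (fun x hx => (hw.2.2 x hx).1) i hx
  refine h1.unique ((hasDerivAt_const (0 : ℝ) (0 : ℝ)).congr_of_eventuallyEq ?_)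
  have hcont : ContinuousAt (fun t : ℝ => x + t • (Pi.single i 1 : Fin n → ℝ)) 0 := by fun_prop
  filter_upwards [hcont.eventually_mem (hw.1.mem_nhds (by simpa using hx))] with t ht
  exact h U w hw _ ht

/-! ### Multiindex powers of commuting endomorphisms -/

section MultiPow

variable {n : ℕ} {V : Type} [AddCommGroup V] [Module ℝ V]

theorem pairwise_commute_pow {T : Fin n → Module.End ℝ V} (hT : ∀ i j, Commute (T i) (T j))
    (α : Fin n → ℕ) :
    ((Finset.univ : Finset (Fin n)) : Set (Fin n)).Pairwise
      (Function.onFun Commute fun i => T i ^ α i) :=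
  fun i _ j _ _ => (hT i j).pow_pow _ _

/-- The power `T^α` of a tuple of commuting endomorphisms. -/
def multiPow (T : Fin n → Module.End ℝ V) (hT : ∀ i j, Commute (T i) (T j)) (α : Fin n → ℕ) :
    Module.End ℝ V :=
  Finset.univ.noncommProd (fun i => T i ^ α i) (pairwise_commute_pow hT α)

variable (T : Fin n → Module.End ℝ V) (hT : ∀ i j, Commute (T i) (T j))

theorem multiPow_zero : multiPow T hT 0 = 1 := by
  exact (Finset.noncommProd_eq_pow_card _ _ _ 1 fun i _ => by simp).trans (one_pow _)

theorem multiPow_add_unitIndex (α : Fin n → ℕ) (i : Fin n) :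
    multiPow T hT (α + unitIndex i) = T i * multiPow T hT α := by
  classical
  unfold multiPow
  rw [← Finset.mul_noncommProd_erase Finset.univ (Finset.mem_univ i) (fun j => T j ^ α j)
      (pairwise_commute_pow hT α),
    ← Finset.mul_noncommProd_erase Finset.univ (Finset.mem_univ i)
      (fun j => T j ^ (α + unitIndex i) j) (pairwise_commute_pow hT _), ← mul_assoc, ← pow_succ']
  congr 1
  · simp [unitIndex]
  · refine Finset.noncommProd_congr rfl (fun j hj => ?_) _
    simp [unitIndex, Pi.single_eq_of_ne (Finset.ne_of_mem_erase hj)]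

theorem multiPow_unitIndex (i : Fin n) : multiPow T hT (unitIndex i) = T i := by
  rw [← zero_add (unitIndex i), multiPow_add_unitIndex, multiPow_zero, mul_one]

theorem exists_add_unitIndex_of_ne_zero {α : Fin n → ℕ} (hα : α ≠ 0) :
    ∃ (i : Fin n) (β : Fin n → ℕ), α = β + unitIndex i := by
  obtain ⟨i, hi⟩ := Function.ne_iff.1 hα
  refine ⟨i, α - unitIndex i, (tsub_add_cancel_of_le fun j => ?_).symm⟩
  by_cases h : j = i
  · subst h
    simpa [unitIndex] using Nat.one_le_iff_ne_zero.2 hi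
  · simp [unitIndex, Pi.single_eq_of_ne h]

theorem multiPow_apply_mem {W : Submodule ℝ V} (hW : ∀ i, ∀ w ∈ W, T i w ∈ W) (α : Fin n → ℕ)
    {w : V} (hw : w ∈ W) : multiPow T hT α w ∈ W := by
  refine Finset.noncommProd_induction Finset.univ _ _ (fun f : Module.End ℝ V => ∀ w ∈ W, f w ∈ W)
    (fun f g hf hg w hw => hf _ (hg _ hw)) (fun w hw => hw) (fun i _ => ?_) w hw
  generalize α i = k
  induction k with
  | zero => exact fun w hw => hw
  | succ k ih =>
    intro w hw
    rw [pow_succ']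
    exact hW i _ (ih w hw)

/-- The operator `g ↦ Σ_α T^α g_α`. -/
def multiPowSum : ((Fin n → ℕ) →₀ V) →ₗ[ℝ] V :=
  Finsupp.lsum ℝ (multiPow T hT)

/-- Summation by parts in abstract form: raising every index by `δ_i` costs one factor `T_i`. -/
theorem multiPowSum_mapDomain (i : Fin n) (f : (Fin n → ℕ) →₀ V) :
    multiPowSum T hT (f.mapDomain (· + unitIndex i)) =
      multiPowSum T hT (f.mapRange (T i) (map_zero _)) := by
  induction f using Finsupp.induction_linear with
  | zero => simp
  | add f g hf hg =>
    rw [Finsupp.mapDomain_add, map_add, hf, hg, Finsupp.mapRange_add (map_add (T i)), map_add]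
  | single α v =>
    have h : Commute (multiPow T hT α) (T i) :=
      (Finset.noncommProd_commute _ _ _ _ fun j _ => (hT i j).pow_right _).symm
    rw [Finsupp.mapDomain_single, Finsupp.mapRange_single]
    simp only [multiPowSum, Finsupp.lsum_single]
    rw [multiPow_add_unitIndex, ← h.eq]
    rfl

/-- If `Σ_α T^α g_α = 0` where `g_α` belongs to an invariant subspace `W` up to contributions `μ_i`
in degrees `δ_i` and `k` in degree `0`, then `k + Σ_i T_i μ_i` is of the form `Σ_i T_i h_i` with
`h_i` in `W`. -/
theorem exists_sum_of_multiPowSum_eq_zero {W : Submodule ℝ V} (hW : ∀ i, ∀ w ∈ W, T i w ∈ W)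
    (g : (Fin n → ℕ) →₀ V) (k : V) (μ : Fin n → V)
    (r : (Fin n → ℕ) →₀ V) (hr : ∀ α, r α ∈ W) (hr₀ : r 0 = 0)
    (hg : g = r + Finsupp.single 0 k + ∑ i, Finsupp.single (unitIndex i) (μ i))
    (h0 : multiPowSum T hT g = 0) :
    ∃ h : Fin n → V, (∀ i, h i ∈ W) ∧ k + ∑ i, T i (μ i) = ∑ i, T i (h i) := by
  -- `Q` is the space `Σ_i T_i W`.
  let Q : Submodule ℝ V :=
    (Submodule.pi Set.univ fun _ : Fin n => W).map (∑ i, T i ∘ₗ LinearMap.proj i)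
  have hQ : ∀ i, ∀ w ∈ W, T i w ∈ Q := by
    classical
    intro i w hw
    refine ⟨Pi.single i w, fun j _ => ?_, ?_⟩
    · by_cases h : j = i
      · subst h
        simpa using hw
      · simp [Pi.single_eq_of_ne h]
    · simp only [LinearMap.sum_apply, LinearMap.comp_apply, LinearMap.proj_apply]
      rw [Finset.sum_eq_single i]
      · simp
      · intro j _ hj
        simp [Pi.single_eq_of_ne hj]
      · simp
  -- Since `r` has no part in degree `0`, every remaining power splits off some `T_i`, and the rest
  -- stays in `W` by invariance.
  have hrQ : multiPowSum T hT r ∈ Q := by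
    simp only [multiPowSum, Finsupp.lsum_apply, Finsupp.sum]
    refine Submodule.sum_mem _ fun α hα => ?_
    have hα0 : α ≠ 0 := by
      rintro rfl
      exact Finsupp.mem_support_iff.1 hα hr₀
    obtain ⟨i, β, rfl⟩ := exists_add_unitIndex_of_ne_zero hα0
    rw [multiPow_add_unitIndex]
    exact hQ i _ (multiPow_apply_mem T hT hW β (hr _))
  have hval : multiPowSum T hT r = -(k + ∑ i, T i (μ i)) := by
    rw [hg, map_add, map_add, map_sum] at h0
    refine eq_neg_of_add_eq_zero_left (Eq.trans ?_ h0)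
    simp only [multiPowSum, Finsupp.lsum_single, multiPow_zero, multiPow_unitIndex,
      Module.End.one_apply, add_assoc]
  rw [hval] at hrQ
  obtain ⟨h, hh, he⟩ := Q.neg_mem hrQ
  refine ⟨h, fun i => hh i trivial, ?_⟩
  rw [neg_neg] at he
  rw [← he]
  simp

end MultiPow

/-! ### The space of differential functions and the Euler operator -/

/-- The space of differential functions on `Ω`, normalized to vanish off `Ω`. -/
def diffFunSpace {n : ℕ} {A : Type} (Ω : Set (Jet n A)) : Submodule ℝ (Jet n A → ℝ) where
  carrier := {f | IsDiffFun Ω f ∧ ∀ z ∉ Ω, f z = 0}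
  add_mem' := fun hf hg => ⟨hf.1.add hg.1, fun z hz => by simp [hf.2 z hz, hg.2 z hz]⟩
  zero_mem' := ⟨IsDiffFun.zero Ω, fun _ _ => rfl⟩
  smul_mem' := fun c _ hf => ⟨hf.1.smul c, fun z hz => by simp [hf.2 z hz]⟩

/-- A differential function on `Ω` as an element of `diffFunSpace Ω`. -/
def IsDiffFun.toSpace {n : ℕ} {A : Type} {Ω : Set (Jet n A)} {f : Jet n A → ℝ}
    (hf : IsDiffFun Ω f) : diffFunSpace Ω :=
  ⟨Ω.indicator f, hf.congr (Set.eqOn_indicator), fun _ hz => Set.indicator_of_notMem hz f⟩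

theorem IsDiffFun.toSpace_apply {n : ℕ} {A : Type} {Ω : Set (Jet n A)} {f : Jet n A → ℝ}
    (hf : IsDiffFun Ω f) {z : Jet n A} (hz : z ∈ Ω) : hf.toSpace.1 z = f z :=
  Set.indicator_of_mem hz f

/-- The normalization off `Ω` turns identities on `Ω` into equalities, so the total derivatives
become genuine commuting endomorphisms. -/
theorem diffFunSpace_ext {n : ℕ} {A : Type} {Ω : Set (Jet n A)} {f g : diffFunSpace Ω}
    (h : Set.EqOn f.1 g.1 Ω) : f = g := by
  refine Subtype.ext (funext fun z => ?_)
  by_cases hz : z ∈ Ω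
  · exact h hz
  · rw [f.2.2 z hz, g.2.2 z hz]

/-- The total derivative on `diffFunSpace Ω`. -/
def totalDerivEnd {n : ℕ} {A : Type} {Ω : Set (Jet n A)} (hΩ : IsOpen Ω) (i : Fin n) :
    Module.End ℝ (diffFunSpace Ω) where
  toFun f := (f.2.1.totalDeriv hΩ i).toSpace
  map_add' f g := diffFunSpace_ext fun z hz => by
    rw [IsDiffFun.toSpace_apply _ hz]
    simp only [Submodule.coe_add, Pi.add_apply]
    rw [IsDiffFun.toSpace_apply _ hz, IsDiffFun.toSpace_apply _ hz,
      totalDeriv_add hΩ f.2.1 g.2.1 i hz]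
  map_smul' c f := diffFunSpace_ext fun z hz => by
    rw [IsDiffFun.toSpace_apply _ hz]
    simp only [Submodule.coe_smul, Pi.smul_apply, RingHom.id_apply]
    rw [IsDiffFun.toSpace_apply _ hz, totalDeriv_smul, smul_eq_mul]

theorem totalDerivEnd_apply {n : ℕ} {A : Type} {Ω : Set (Jet n A)} (hΩ : IsOpen Ω) (i : Fin n)
    (f : diffFunSpace Ω) {z : Jet n A} (hz : z ∈ Ω) :
    (totalDerivEnd hΩ i f).1 z = totalDeriv i f.1 z :=
  (f.2.1.totalDeriv hΩ i).toSpace_apply hz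

theorem totalDerivEnd_commute {n : ℕ} {A : Type} {Ω : Set (Jet n A)} (hΩ : IsOpen Ω)
    (i j : Fin n) : Commute (totalDerivEnd hΩ i) (totalDerivEnd hΩ j) := by
  refine LinearMap.ext fun f => diffFunSpace_ext fun z hz => ?_
  simp only [Module.End.mul_apply]
  have h : ∀ i, Set.EqOn (totalDerivEnd hΩ i f).1 (totalDeriv i f.1) Ω := fun i y hy =>
    totalDerivEnd_apply hΩ i f hy
  rw [totalDerivEnd_apply hΩ _ _ hz, totalDerivEnd_apply hΩ _ _ hz,
    totalDeriv_congr hΩ (h j) i hz, totalDeriv_congr hΩ (h i) j hz,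
    totalDeriv_comm hΩ f.2.1 i j hz]

/-- The family of the derivatives `∂f/∂u^a_α`, indexed by `α`. -/
def jetPartials {n : ℕ} {A : Type} {Ω : Set (Jet n A)} (hΩ : IsOpen Ω) (a : A)
    {f : Jet n A → ℝ} (hf : IsDiffFun Ω f) : (Fin n → ℕ) →₀ diffFunSpace Ω :=
  Finsupp.ofSupportFinite (fun α => (hf.jetPartial hΩ (Sum.inr (a, α))).toSpace) <| by
    obtain ⟨S, hS⟩ := hf.exists_finset hΩ
    refine (S.finite_toSet.preimage
      (f := fun α : Fin n → ℕ => (Sum.inr (a, α) : JetVar n A)) ?_).subset fun α hα => ?_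
    · intro α _ β _ h
      simpa using h
    · by_contra h
      exact hα (diffFunSpace_ext fun z hz => (IsDiffFun.toSpace_apply _ hz).trans (hS _ h hz))

theorem jetPartials_apply {n : ℕ} {A : Type} {Ω : Set (Jet n A)} (hΩ : IsOpen Ω) (a : A)
    {f : Jet n A → ℝ} (hf : IsDiffFun Ω f) (α : Fin n → ℕ) {z : Jet n A} (hz : z ∈ Ω) :
    (jetPartials hΩ a hf α).1 z = jetPartial (Sum.inr (a, α)) f z :=
  (hf.jetPartial hΩ _).toSpace_apply hz

/-- Both commutation cases in one formula. The sign is arranged so that `multiPowSum_mapDomain` with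
`T = -D` makes the two terms cancel. -/
theorem jetPartials_totalDeriv {n : ℕ} {A : Type} {Ω : Set (Jet n A)} (hΩ : IsOpen Ω) (a : A)
    {f : Jet n A → ℝ} (hf : IsDiffFun Ω f) (i : Fin n) :
    jetPartials hΩ a (hf.totalDeriv hΩ i) =
      (jetPartials hΩ a hf).mapDomain (· + unitIndex i) -
        (jetPartials hΩ a hf).mapRange (-totalDerivEnd hΩ i : Module.End ℝ (diffFunSpace Ω))
          (map_zero _) := by
  have hD : ∀ α, ∀ z ∈ Ω, (totalDerivEnd hΩ i (jetPartials hΩ a hf α)).1 z =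
      totalDeriv i (jetPartial (Sum.inr (a, α)) f) z := fun α z hz => by
    rw [totalDerivEnd_apply hΩ i _ hz]
    exact totalDeriv_congr hΩ (fun y hy => jetPartials_apply hΩ a hf α hy) i hz
  refine Finsupp.ext fun α => diffFunSpace_ext fun z hz => ?_
  rw [jetPartials_apply hΩ a _ α hz]
  simp only [Finsupp.sub_apply, Finsupp.mapRange_apply, LinearMap.neg_apply, sub_neg_eq_add,
    Submodule.coe_add, Pi.add_apply, hD α z hz]
  by_cases hα : α ∈ Set.range (· + unitIndex i)
  · obtain ⟨β, rfl⟩ := hα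
    rw [Finsupp.mapDomain_apply (add_left_injective (unitIndex i)), jetPartials_apply hΩ a hf β hz,
      jetPartial_totalDeriv_add hΩ hf i a β hz, add_comm]
  · rw [Finsupp.mapDomain_of_notMem_range _ _ hα,
      jetPartial_totalDeriv_of_notMem_range hΩ hf i a hα hz]
    simp

theorem jetPartials_totalDiv {n : ℕ} {A : Type} {Ω : Set (Jet n A)} (hΩ : IsOpen Ω) (a : A)
    {F : Fin n → Jet n A → ℝ} (hF : ∀ i, IsDiffFun Ω (F i)) :
    jetPartials hΩ a (IsDiffFun.totalDiv hΩ hF) =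
      ∑ i, jetPartials hΩ a ((hF i).totalDeriv hΩ i) := by
  refine Finsupp.ext fun α => diffFunSpace_ext fun z hz => ?_
  have h : totalDiv F = ∑ i, totalDeriv i (F i) := by
    funext z
    simp [totalDiv]
  rw [jetPartials_apply hΩ a _ α hz, h,
    jetPartial_sum hΩ Finset.univ (fun i => (hF i).totalDeriv hΩ i) _ hz]
  simp only [Finsupp.finsetSum_apply, AddSubmonoidClass.coe_finsetSum, Finset.sum_apply,
    jetPartials_apply hΩ a _ α hz]

theorem neg_totalDerivEnd_commute {n : ℕ} {A : Type} {Ω : Set (Jet n A)} (hΩ : IsOpen Ω)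
    (i j : Fin n) : Commute (-totalDerivEnd hΩ i) (-totalDerivEnd hΩ j) :=
  LinearMap.ext fun f => by
    have h := LinearMap.congr_fun (totalDerivEnd_commute hΩ i j) f
    simpa only [Module.End.mul_apply, LinearMap.neg_apply, map_neg, neg_neg] using h

/-- The Euler operator `Σ_α (-D)^α ∂/∂u^a_α` annihilates total divergences. -/
theorem euler_totalDiv {n : ℕ} {A : Type} {Ω : Set (Jet n A)} (hΩ : IsOpen Ω) (a : A)
    {F : Fin n → Jet n A → ℝ} (hF : ∀ i, IsDiffFun Ω (F i)) :
    multiPowSum (fun i => -totalDerivEnd hΩ i) (neg_totalDerivEnd_commute hΩ)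
      (jetPartials hΩ a (IsDiffFun.totalDiv hΩ hF)) = 0 := by
  rw [jetPartials_totalDiv hΩ a hF, map_sum]
  refine Finset.sum_eq_zero fun i _ => ?_
  rw [jetPartials_totalDeriv hΩ a (hF i), map_sub, multiPowSum_mapDomain, sub_self]

open Classical in
/-- If the derivatives of a total divergence with respect to `u^a_α` vanish on the solutions of `L`
up to the contributions `μ_i` for `α = δ_i`, then its derivative with respect to `u^a` is the total
divergence of a tuple equal to `μ` on the solutions. -/
theorem DESystem.exists_totalDiv_add_eq {n : ℕ} {A E : Type} (L : DESystem n A E) (a : A)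
    {F : Fin n → Jet n A → ℝ} (hF : ∀ i, IsDiffFun L.dom (F i))
    {c : (Fin n → ℕ) → Jet n A → ℝ} (hcv : ∀ α, L.VanishesOnSolutions (c α))
    {μ : Fin n → Jet n A → ℝ} (hμ : ∀ i, IsDiffFun L.dom (μ i))
    (h : ∀ α, ∀ z ∈ L.dom, jetPartial (Sum.inr (a, α)) (totalDiv F) z =
      c α z + ∑ i, if α = unitIndex i then μ i z else 0) :
    ∃ H ∈ L.vanishingTuples, ∀ z ∈ L.dom, totalDiv (μ + H) z = c 0 z := by
  have hΩ := L.isOpen_dom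
  -- The functions vanishing on solutions form the invariant subspace of the algebraic lemma.
  let W : Submodule ℝ (diffFunSpace L.dom) :=
    { carrier := {f | L.VanishesOnSolutions f.1}
      add_mem' := fun hf hg U w hw x hx => by simp [hf U w hw x hx, hg U w hw x hx]
      zero_mem' := fun U w hw x hx => rfl
      smul_mem' := fun c f hf U w hw x hx => by simp [hf U w hw x hx] }
  have hW : ∀ i, ∀ f ∈ W, (-totalDerivEnd hΩ i) f ∈ W := by
    intro i f hf
    refine W.neg_mem fun U w hw x hx => ?_
    rw [totalDerivEnd_apply hΩ i f (hw.2.2 x hx).1]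
    exact DESystem.VanishesOnSolutions.totalDeriv f.2.1 hf i U w hw x hx
  have hδ : ∀ i : Fin n, (unitIndex i : Fin n → ℕ) ≠ 0 := fun i h => by
    simpa [unitIndex] using congrFun h i
  set g := jetPartials hΩ a (IsDiffFun.totalDiv hΩ hF) with hg
  -- Degree `0` is removed entirely, since it must survive as the resulting divergence; what is left
  -- is `c α` in the degrees `α ≠ 0`.
  let r : (Fin n → ℕ) →₀ diffFunSpace L.dom :=
    g - Finsupp.single 0 (g 0) - ∑ i, Finsupp.single (unitIndex i) (hμ i).toSpace
  have hr : ∀ α, ∀ z ∈ L.dom, (r α).1 z = if α = 0 then 0 else c α z := by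
    intro α z hz
    have hs : ((∑ i, Finsupp.single (unitIndex i) (hμ i).toSpace) α).1 z =
        ∑ i, if α = unitIndex i then μ i z else 0 := by
      simp only [Finsupp.finsetSum_apply, AddSubmonoidClass.coe_finsetSum, Finset.sum_apply]
      refine Finset.sum_congr rfl fun i _ => ?_
      by_cases hi : α = unitIndex i
      · subst hi
        rw [Finsupp.single_eq_same, if_pos rfl, IsDiffFun.toSpace_apply _ hz]
      · rw [Finsupp.single_eq_of_ne hi, if_neg hi]
        rfl
    simp only [r, Finsupp.sub_apply, Submodule.coe_sub, Pi.sub_apply, hs]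
    by_cases hα : α = 0
    · subst hα
      simp [(hδ _).symm]
    · rw [Finsupp.single_eq_of_ne hα, if_neg hα, hg, jetPartials_apply hΩ a _ α hz, h α z hz]
      simp
  obtain ⟨H, hHW, hH⟩ := exists_sum_of_multiPowSum_eq_zero _ (neg_totalDerivEnd_commute hΩ) hW g
    (g 0) (fun i => (hμ i).toSpace) r
    (fun α U w hw x hx => by
      rw [hr α _ (hw.2.2 x hx).1]
      split_ifs
      · rfl
      · exact hcv α U w hw x hx)
    (diffFunSpace_ext fun z hz => by rw [hr 0 z hz, if_pos rfl]; rfl)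
    (by simp only [r]; abel) (euler_totalDiv hΩ a hF)
  -- With `T_i = -D_i` the relation reads `g 0 - Σ D_i μ_i = -Σ D_i H_i`, so the correction to `μ`
  -- is `-H`.
  have hv : (fun i => (-H i).1) ∈ L.vanishingTuples := fun i => ⟨(-H i).2.1, W.neg_mem (hHW i)⟩
  refine ⟨_, hv, fun z hz => ?_⟩
  have hz' := congrFun (congrArg Subtype.val hH) z
  simp only [LinearMap.neg_apply, Submodule.coe_add, Pi.add_apply, AddSubmonoidClass.coe_finsetSum,
    Finset.sum_apply, Submodule.coe_neg, Pi.neg_apply, Finset.sum_neg_distrib,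
    totalDerivEnd_apply hΩ _ _ hz, hg, jetPartials_apply hΩ a _ _ hz, h 0 z hz] at hz'
  have h1 : ∀ i, totalDeriv i (hμ i).toSpace.1 z = totalDeriv i (μ i) z := fun i =>
    totalDeriv_congr hΩ (fun y hy => IsDiffFun.toSpace_apply _ hy) i hz
  have h2 : ∀ i, totalDeriv i (-H i).1 z = - totalDeriv i (H i).1 z := fun i => by
    simpa using totalDeriv_smul (-1) (H i).1 i z
  rw [totalDiv_add hΩ hμ (fun i => (hv i).1) hz]
  simp only [totalDiv, h2, Finset.sum_neg_distrib]
  simp only [h1, (hδ _).symm, if_false, Finset.sum_const_zero, add_zero] at hz'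
  linarith

theorem DESystem.vanishingTuples_le_CV {n : ℕ} {A E : Type} (L : DESystem n A E) :
    L.vanishingTuples ≤ L.CV := by
  refine fun F hF => ⟨fun i => (hF i).1, fun U w hw x hx => Finset.sum_eq_zero fun i _ => ?_⟩
  exact DESystem.VanishesOnSolutions.totalDeriv (hF i).1 (hF i).2 i U w hw x hx

/-- The difference of the two conserved vectors has identically zero divergence, hence is trivial.
-/
theorem DESystem.IsCharacteristicOf.unique {n : ℕ} {A E : Type} [Fintype E] {L : DESystem n A E}
    {lam : E → Jet n A → ℝ} {𝓕 𝓖 : L.CL} (hF : L.IsCharacteristicOf lam 𝓕)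
    (hG : L.IsCharacteristicOf lam 𝓖) : 𝓕 = 𝓖 := by
  obtain ⟨-, F, ⟨hF, rfl⟩, hFd⟩ := hF
  obtain ⟨-, G, ⟨hG, rfl⟩, hGd⟩ := hG
  refine (Submodule.Quotient.eq _).2 (Submodule.mem_sup_right ?_)
  have hn : ∀ i, IsDiffFun L.dom (((-1 : ℝ) • G) i) := fun i => (hG.1 i).smul (-1)
  have he : F - G = F + (-1 : ℝ) • G := by rw [neg_one_smul, sub_eq_add_neg]
  change F - G ∈ L.nullDivergences
  rw [he]
  refine ⟨fun i => (hF.1 i).add (hn i), fun z hz => ?_⟩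
  rw [totalDiv_add L.isOpen_dom hF.1 hn hz, totalDiv_smul, hFd z hz, hGd z hz]
  ring

/-! ### Potential systems -/

/-- Functions pulled back from the base, such as `G^{si}` and `L^ν`, are therefore independent of
the potentials and all their derivatives. -/
theorem jetProj_setCoord_potVar {n m p : ℕ} (z : Jet n (Fin m ⊕ Fin p)) (s : Fin p)
    (α : Fin n → ℕ) (t : ℝ) : jetProj (setCoord z (potVar s α) t) = jetProj z := by
  funext r
  rcases r with i | q <;> simp [jetProj, setCoord, potVar]

open Classical in
theorem PotentialFrame.jetPartial_system_eqn_inl {n m p l : ℕ} (P : PotentialFrame n m p l)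
    (ε : ℤˣ) (s : Fin p) (α : Fin n → ℕ) (q : Fin p × Fin n) (z : Jet n (Fin m ⊕ Fin p)) :
    jetPartial (potVar s α) ((P.system ε).eqn (Sum.inl q)) z =
      if q.1 = s ∧ α = unitIndex q.2 then ((ε : ℤ) : ℝ) else 0 := by
  have h : jetPartial (potVar s α) (fun z => z (potVar q.1 (unitIndex q.2))) z =
      if q.1 = s ∧ α = unitIndex q.2 then 1 else 0 := by
    have hiff : potVar (m := m) q.1 (unitIndex q.2) = potVar s α ↔ q.1 = s ∧ α = unitIndex q.2 := by
      simp [potVar, eq_comm]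
    rw [jetPartial_coord]
    by_cases hq : q.1 = s ∧ α = unitIndex q.2
    · rw [if_pos (hiff.2 hq), if_pos hq]
    · rw [if_neg (mt hiff.1 hq), if_neg hq]
  simp only [jetPartial] at h
  simp only [jetPartial, PotentialFrame.system, Sum.elim_inl, jetProj_setCoord_potVar,
    deriv_const_mul_field, deriv_sub_const]
  rw [h]
  simp

theorem PotentialFrame.jetPartial_system_eqn_inr {n m p l : ℕ} (P : PotentialFrame n m p l)
    (ε : ℤˣ) (s : Fin p) (α : Fin n → ℕ) (ν : P.N) (z : Jet n (Fin m ⊕ Fin p)) :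
    jetPartial (potVar s α) ((P.system ε).eqn (Sum.inr ν)) z = 0 := by
  simp [jetPartial, PotentialFrame.system, jetProj_setCoord_potVar]

end

/-! ### The conserved vector `λ^s` and its characteristic. -/

theorem mainTheorem11 {n m p l : ℕ} (P : AbelianCovering n m p l) (ε : ℤˣ)
    (lam : (Fin p × Fin n) ⊕ P.N → Jet n (Fin m ⊕ Fin p) → ℝ)
    (𝓕 : (P.system ε).CL) (hlam : (P.system ε).IsCharacteristicOf lam 𝓕) (s : Fin p) :
    (fun i => lam (Sum.inl (s, i))) ∈ (P.system ε).CV ∧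
    ∃ 𝓖 : (P.system ε).CL,
      (P.system ε).IsConservedVectorOf (fun i => lam (Sum.inl (s, i))) 𝓖 ∧
      (P.system ε).IsCharacteristicOf
        (fun e => ((ε : ℤ) : ℝ) • jetPartial (potVar s 0) (lam e)) 𝓖 ∧
      ∀ 𝓖' : (P.system ε).CL,
        (P.system ε).IsCharacteristicOf
          (fun e => ((ε : ℤ) : ℝ) • jetPartial (potVar s 0) (lam e)) 𝓖' → 𝓖' = 𝓖 := by
  classical
  set L := P.system ε with hL
  have hΩ := L.isOpen_dom
  obtain ⟨hlamd, F, ⟨⟨hF, -⟩, -⟩, hFd⟩ := hlam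
  set e : ℝ := ((ε : ℤ) : ℝ) with he
  have hee : e * e = 1 := by
    rw [he, ← Int.cast_mul, ← Units.val_mul, Int.units_mul_self]
    simp
  set μ : Fin n → Jet n (Fin m ⊕ Fin p) → ℝ := fun i => lam (Sum.inl (s, i)) with hμ
  have hμd : ∀ i, IsDiffFun L.dom ((e • μ) i) := fun i => (hlamd _).smul e
  -- Product rule on `λ·L`: terms differentiating `λ` keep a factor `L`, and those differentiating
  -- `L` survive only for the equations of `v^s_i` with `α = δ_i`.
  have hpart : ∀ α, ∀ z ∈ L.dom, jetPartial (potVar s α) (totalDiv F) z =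
      (∑ k, jetPartial (potVar s α) (lam k) z * L.eqn k z) +
        ∑ i, if α = unitIndex i then (e • μ) i z else 0 := by
    intro α z hz
    have h1 : Set.EqOn (totalDiv F) (∑ k, lam k * L.eqn k) L.dom := fun y hy => by
      rw [hFd y hy]
      simp only [Finset.sum_apply, Pi.mul_apply]
      rfl
    rw [jetPartial_congr hΩ h1 _ hz, jetPartial_sum hΩ Finset.univ
      (fun k => (hlamd k).mul (L.isDiffFun_eqn k)) _ hz]
    simp only [jetPartial_mul hΩ (hlamd _) (L.isDiffFun_eqn _) _ hz, Finset.sum_add_distrib]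
    congr 1
    rw [Fintype.sum_sum_type, Fintype.sum_prod_type]
    simp only [hL, PotentialFrame.jetPartial_system_eqn_inl,
      PotentialFrame.jetPartial_system_eqn_inr, mul_zero, Finset.sum_const_zero, add_zero]
    rw [Finset.sum_eq_single s]
    · refine Finset.sum_congr rfl fun i _ => ?_
      by_cases h : α = unitIndex i
      · simp [h, hμ, he, mul_comm]
      · simp [h]
    · intro σ _ hσ
      simp [hσ]
    · simp
  have hvan : ∀ α, L.VanishesOnSolutions
      (fun z => ∑ k, jetPartial (potVar s α) (lam k) z * L.eqn k z) := fun α U w hw x hx =>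
    Finset.sum_eq_zero fun k _ => by rw [(hw.2.2 x hx).2 k, mul_zero]
  obtain ⟨H, hH, hdiv⟩ := L.exists_totalDiv_add_eq (Sum.inr s) hF hvan hμd hpart
  -- The Euler operator yields `ε μ`; a second factor `ε` restores `μ` and produces the `ε` in the
  -- characteristic.
  have hμF : e • (e • μ + H) = μ + e • H := by
    rw [smul_add, smul_smul, hee, one_smul]
  have hdiv' : ∀ z ∈ L.dom, totalDiv (μ + e • H) z =
      ∑ k, (e • jetPartial (potVar s 0) (lam k)) z * L.eqn k z := fun z hz => by
    rw [← hμF, totalDiv_smul, hdiv z hz, Finset.mul_sum]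
    simp only [Pi.smul_apply, smul_eq_mul, mul_assoc]
  have heH : e • H ∈ L.vanishingTuples := L.vanishingTuples.smul_mem e hH
  -- The divergence is a combination of the equations, so it vanishes on solutions; removing the
  -- vanishing tuple, itself conserved, leaves `μ`.
  have hsum : μ + e • H ∈ L.CV :=
    ⟨fun i => (hlamd _).add (heH i).1, fun U w hw x hx => by
      rw [hdiv' _ (hw.2.2 x hx).1]
      exact Finset.sum_eq_zero fun k _ => by rw [(hw.2.2 x hx).2 k, mul_zero]⟩
  have hμCV : μ ∈ L.CV := by
    simpa using L.CV.sub_mem hsum (L.vanishingTuples_le_CV heH)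
  have hchar : L.IsCharacteristicOf (fun k => e • jetPartial (potVar s 0) (lam k))
      (Submodule.Quotient.mk ⟨μ, hμCV⟩) := by
    refine ⟨fun k => ((hlamd k).jetPartial hΩ _).smul e, μ + e • H, ⟨hsum, ?_⟩, hdiv'⟩
    refine (Submodule.Quotient.eq _).2 (Submodule.mem_sup_left ?_)
    change μ + e • H - μ ∈ L.vanishingTuples
    rwa [add_sub_cancel_left]
  exact ⟨hμCV, _, ⟨hμCV, rfl⟩, hchar, fun 𝓖' h𝓖 => h𝓖.unique hchar⟩
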